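/- Let $H$ be a complex Hilbert space, not necessarily finite dimensional, and let $S(H)$ be the set of states (density operators) on $H$, i.e. the positive trace-class operators on $H$ with trace $1$. The pure states are the extreme points of $S(H)$ (equivalently, the rank-one projections). A function $C : S(H)\times S(H)\to[0,1]$ is called compatibility-like if for all $A,B\in S(H)$: (i) $C(A,B)=0$ if and only if $\operatorname{ran} A^{1/2}\cap \operatorname{ran} B^{1/2}=\{0\}$; (ii) $C(A,B)=C(B,A)$; (iii) if $P$ is a pure state, then $C(A,P)^2=\sup\{\lambda\in[0,1] : \lambda P\le A\}$, where $\le$ is the usual order of self-adjoint operators. Theorem. Let $C$ be a compatibility-like function on $S(H)$ and let $\phi:S(H)\to S(H)$ be a bijection with $C(\phi(A),\phi(B))=C(A,B)$ for all $A,B\in S(H)$. Then there exists an either unitary or antiunitary operator $U$ on $H$ such that $$\phi(A)=UAU^* \qquad (A\in S(H)).$$ -/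

import Mathlib

universe u

section CompatibilityLike

variable {H : Type u} [NormedAddCommGroup H] [InnerProductSpace ℂ H] [CompleteSpace H]

/-- `T` has trace `t`: for every orthonormal (Hilbert) basis `(eᵢ)` of `H` the family
`⟪eᵢ, T eᵢ⟫` is (unconditionally) summable with sum `t`. For a positive bounded operator this says
exactly that `T` is of trace class with `tr T = t`. (All Hilbert bases of `H` can be indexed by
types in the universe of `H`.) -/
def HasTrace (T : H →L[ℂ] H) (t : ℂ) : Prop :=
  ∀ (ι : Type u) (e : HilbertBasis ι ℂ H), HasSum (fun i => inner ℂ (e i) (T (e i))) t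

variable (H) in
/-- `S(H)`: the states (density operators) on `H`, that is, the positive trace-class operators of
trace `1`. -/
def stateSet : Set (H →L[ℂ] H) :=
  {A | 0 ≤ A ∧ HasTrace A 1}

/-- Pure states: the extreme points of the convex set `S(H)`. -/
def IsPureState (P : stateSet H) : Prop :=
  (P : H →L[ℂ] H) ∈ (stateSet H).extremePoints ℝ

/-- Compatibility-like functions `C : S(H) × S(H) → [0,1]`. Here `≤` is the usual (Loewner) order
of operators and `CFC.sqrt A` is the positive square root of the positive operator `A`. -/
structure IsCompatibilityLike (C : stateSet H → stateSet H → ℝ) : Prop where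
  mem_Icc : ∀ A B, C A B ∈ Set.Icc (0 : ℝ) 1
  eq_zero_iff : ∀ A B, C A B = 0 ↔
    (CFC.sqrt (A : H →L[ℂ] H)).range ⊓ (CFC.sqrt (B : H →L[ℂ] H)).range = ⊥
  symmetric : ∀ A B, C A B = C B A
  sq_eq_sSup : ∀ A P, IsPureState P →
    C A P ^ 2 = sSup {r : ℝ | r ∈ Set.Icc (0 : ℝ) 1 ∧ r • (P : H →L[ℂ] H) ≤ (A : H →L[ℂ] H)}

end CompatibilityLike

/-! ### Positive operators, states and the order-theoretic description of pure states -/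

section PositiveOperators

open InnerProductSpace ContinuousLinearMap
open scoped ComplexOrder

variable {H : Type u} [NormedAddCommGroup H] [InnerProductSpace ℂ H] [CompleteSpace H]

/-! The zeros of `C` detect pure states: `A` is a rank-one projection exactly when `ran A^{1/2}` is
minimal, and minimality can be phrased through the relation `C A D = 0` alone
(`exists_eq_unitState_iff`). Hence `φ` permutes the pure states, and by (iii) it preserves the
strength `λ(A, x)`, the largest `λ` with `λ P_x ≤ A`.

Strengths determine transition probabilities. For orthonormal `p, q` the state `A = 2/3 P_p + 1/3
P_q` is recognised by its strengths: all are at most `2/3`, the nonzero ones are at least `1/3`, and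
`2/3` is attained at `p` (`exists_eq_pairOperator`). So its image has the same shape, and the
strength of `A` along a unit vector `r` in the span of `p, q` is a function of `|⟨p, r⟩|`. Thus `φ`
preserves `|⟨p, r⟩|`, and `wigner` yields a unitary or antiunitary `U` that implements `φ` on pure
states.

Finally, `⟨A y, y⟩` is the maximum over unit `x` of `λ(A, x) |⟨x, y⟩|²`, attained along `A y` when
`A y ≠ 0`. A state is therefore recovered from its strengths, so `φ A` and `U A U*` agree. -/

theorem sqrt_comp_sqrt_apply {A : H →L[ℂ] H} (hA : 0 ≤ A) (y : H) :
    CFC.sqrt A (CFC.sqrt A y) = A y := by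
  conv_rhs => rw [← CFC.sqrt_mul_sqrt_self A hA]
  rfl

theorem inner_apply_eq_inner_sqrt {A : H →L[ℂ] H} (hA : 0 ≤ A) (y z : H) :
    inner ℂ (A y) z = inner ℂ (CFC.sqrt A y) (CFC.sqrt A z) := by
  have hS : (CFC.sqrt A).IsPositive := (nonneg_iff_isPositive _).1 (CFC.sqrt_nonneg A)
  rw [← sqrt_comp_sqrt_apply hA y, hS.inner_left_eq_inner_right]

theorem re_inner_apply_eq_norm_sqrt_sq {A : H →L[ℂ] H} (hA : 0 ≤ A) (y : H) :
    (inner ℂ (A y) y).re = ‖CFC.sqrt A y‖ ^ 2 := by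
  rw [inner_apply_eq_inner_sqrt hA, ← inner_self_eq_norm_sq (𝕜 := ℂ)]
  rfl

theorem re_inner_apply_nonneg {A : H →L[ℂ] H} (hA : 0 ≤ A) (y : H) :
    0 ≤ (inner ℂ (A y) y).re := by
  rw [re_inner_apply_eq_norm_sqrt_sq hA]
  positivity

theorem inner_apply_eq_ofReal {A : H →L[ℂ] H} (hA : 0 ≤ A) (y : H) :
    inner ℂ (A y) y = ((inner ℂ (A y) y).re : ℂ) := by
  rw [inner_apply_eq_inner_sqrt hA, inner_self_eq_norm_sq_to_K]
  norm_cast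

theorem norm_inner_apply_sq_le {A : H →L[ℂ] H} (hA : 0 ≤ A) (y z : H) :
    ‖inner ℂ (A y) z‖ ^ 2 ≤ (inner ℂ (A y) y).re * (inner ℂ (A z) z).re := by
  rw [inner_apply_eq_inner_sqrt hA y z, re_inner_apply_eq_norm_sqrt_sq hA,
    re_inner_apply_eq_norm_sqrt_sq hA, ← mul_pow]
  gcongr
  exact norm_inner_le_norm _ _

theorem apply_eq_zero_of_re_inner_eq_zero {A : H →L[ℂ] H} (hA : 0 ≤ A) {y : H}
    (h : (inner ℂ (A y) y).re = 0) : A y = 0 := by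
  rw [re_inner_apply_eq_norm_sqrt_sq hA] at h
  have : CFC.sqrt A y = 0 := by simpa using h
  rw [← sqrt_comp_sqrt_apply hA, this, map_zero]

omit [CompleteSpace H] in
theorem inner_ofReal_smul_left (r : ℝ) (x y : H) : inner ℂ (r • x) y = (r : ℂ) * inner ℂ x y := by
  rw [← Complex.coe_smul, inner_smul_left, Complex.conj_ofReal]

omit [CompleteSpace H] in
theorem inner_rankOne_self_apply (x y : H) :
    inner ℂ (rankOne ℂ x x y) y = ((‖inner ℂ x y‖ ^ 2 : ℝ) : ℂ) := by
  rw [rankOne_apply, inner_smul_left, RCLike.conj_mul]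
  norm_cast

omit [CompleteSpace H] in
theorem rankOne_self_nonneg (x : H) : 0 ≤ rankOne ℂ x x :=
  (nonneg_iff_isPositive _).2 (isPositive_rankOne_self x)

theorem smul_rankOne_le_iff {A : H →L[ℂ] H} (hA : 0 ≤ A) (x : H) (r : ℝ) :
    r • rankOne ℂ x x ≤ A ↔ ∀ y, r * ‖inner ℂ x y‖ ^ 2 ≤ (inner ℂ (A y) y).re := by
  have key (y : H) : inner ℂ ((A - r • rankOne ℂ x x) y) y
      = (((inner ℂ (A y) y).re - r * ‖inner ℂ x y‖ ^ 2 : ℝ) : ℂ) := by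
    rw [sub_apply, inner_sub_left, smul_apply, inner_ofReal_smul_left,
      inner_rankOne_self_apply, inner_apply_eq_ofReal hA]
    push_cast
    rfl
  rw [le_def, isPositive_iff_complex]
  refine forall_congr' fun y => ?_
  have hre : RCLike.re (inner ℂ ((A - r • rankOne ℂ x x) y) y)
      = (inner ℂ (A y) y).re - r * ‖inner ℂ x y‖ ^ 2 := by rw [key]; exact Complex.ofReal_re _
  rw [hre, sub_nonneg]
  exact and_iff_right (key y).symm

/-! ### Traces -/

theorem HasTrace.unique {A : H →L[ℂ] H} {s t : ℂ} (hs : HasTrace A s) (ht : HasTrace A t) :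
    s = t := by
  obtain ⟨w, b, -⟩ := exists_hilbertBasis ℂ H
  exact (hs _ b).unique (ht _ b)

omit [CompleteSpace H] in
theorem HasTrace.add {A B : H →L[ℂ] H} {s t : ℂ} (hA : HasTrace A s) (hB : HasTrace B t) :
    HasTrace (A + B) (s + t) := fun ι e => by
  simpa [inner_add_right] using (hA ι e).add (hB ι e)

omit [CompleteSpace H] in
theorem HasTrace.smul {A : H →L[ℂ] H} {t : ℂ} (hA : HasTrace A t) (c : ℂ) :
    HasTrace (c • A) (c * t) := fun ι e => by
  simpa [inner_smul_right] using (hA ι e).mul_left c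

omit [CompleteSpace H] in
theorem HasTrace.real_smul {A : H →L[ℂ] H} {t : ℂ} (hA : HasTrace A t) (c : ℝ) :
    HasTrace (c • A) (c * t) := by
  simpa using hA.smul (c : ℂ)

omit [CompleteSpace H] in
theorem hasTrace_rankOne_self (x : H) : HasTrace (rankOne ℂ x x) ((‖x‖ : ℂ) ^ 2) := fun ι e => by
  have := e.hasSum_inner_mul_inner x x
  rw [inner_self_eq_norm_sq_to_K] at this
  simpa [inner_smul_right, mul_comm] using this

omit [CompleteSpace H] in
theorem rankOne_self_mem_stateSet {x : H} (hx : ‖x‖ = 1) : rankOne ℂ x x ∈ stateSet H :=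
  ⟨rankOne_self_nonneg x, by simpa [hx] using hasTrace_rankOne_self x⟩

/-- The rank-one projection onto the line spanned by the unit vector `x`, as a state. -/
noncomputable def unitState (x : H) (hx : ‖x‖ = 1) : stateSet H :=
  ⟨rankOne ℂ x x, rankOne_self_mem_stateSet hx⟩

theorem sum_re_inner_apply_le_one {A : H →L[ℂ] H} (hA : A ∈ stateSet H) {ι : Type*} [Fintype ι]
    {v : ι → H} (hv : Orthonormal ℂ v) : ∑ i, (inner ℂ (A (v i)) (v i)).re ≤ 1 := by
  obtain ⟨w, b, hw, hb⟩ := hv.toSubtypeRange.exists_hilbertBasis_extension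
  have hsum := Complex.hasSum_re (hA.2 w b)
  have hre (i : w) : (inner ℂ (b i) (A (b i))).re = (inner ℂ (A (b i)) (b i)).re :=
    inner_re_symm (𝕜 := ℂ) _ _
  simp_rw [hre] at hsum
  let j : ι ↪ w := ⟨fun i => ⟨v i, hw ⟨i, rfl⟩⟩, fun i k h =>
    hv.linearIndependent.injective (congrArg Subtype.val h)⟩
  have := sum_le_hasSum (Finset.univ.map j) (fun i _ => re_inner_apply_nonneg hA.1 (b i)) hsum
  rw [Finset.sum_map] at this
  rw [hb] at this
  exact this

theorem re_inner_apply_le_one {A : H →L[ℂ] H} (hA : A ∈ stateSet H) {x : H} (hx : ‖x‖ = 1) :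
    (inner ℂ (A x) x).re ≤ 1 := by
  have hv : Orthonormal ℂ ![x] := by
    rw [orthonormal_iff_ite]
    intro i j
    fin_cases i; fin_cases j
    simp [inner_self_eq_norm_sq_to_K, hx]
  simpa using sum_re_inner_apply_le_one hA hv

theorem re_inner_apply_add_le_one {A : H →L[ℂ] H} (hA : A ∈ stateSet H) {x y : H}
    (hx : ‖x‖ = 1) (hy : ‖y‖ = 1) (hxy : inner ℂ x y = 0) :
    (inner ℂ (A x) x).re + (inner ℂ (A y) y).re ≤ 1 := by
  have hv : Orthonormal ℂ ![x, y] := by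
    rw [orthonormal_iff_ite]
    intro i j
    fin_cases i <;> fin_cases j <;>
      simp [inner_self_eq_norm_sq_to_K, hx, hy, hxy, inner_eq_zero_symm.1 hxy]
  simpa using sum_re_inner_apply_le_one hA hv

theorem re_inner_apply_add_add_le_one {A : H →L[ℂ] H} (hA : A ∈ stateSet H) {x y z : H}
    (hx : ‖x‖ = 1) (hy : ‖y‖ = 1) (hz : ‖z‖ = 1) (hxy : inner ℂ x y = 0)
    (hxz : inner ℂ x z = 0) (hyz : inner ℂ y z = 0) :
    (inner ℂ (A x) x).re + (inner ℂ (A y) y).re + (inner ℂ (A z) z).re ≤ 1 := by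
  have hv : Orthonormal ℂ ![x, y, z] := by
    rw [orthonormal_iff_ite]
    intro i j
    fin_cases i <;> fin_cases j <;>
      simp [inner_self_eq_norm_sq_to_K, hx, hy, hz, hxy, hxz, hyz, inner_eq_zero_symm.1 hxy,
        inner_eq_zero_symm.1 hxz, inner_eq_zero_symm.1 hyz]
  have := sum_re_inner_apply_le_one hA hv
  simpa [Fin.sum_univ_succ, add_assoc] using this

omit [CompleteSpace H] in
theorem sub_inner_smul_orthogonal {x : H} (hx : ‖x‖ = 1) (y : H) :
    inner ℂ x (y - inner ℂ x y • x) = 0 := by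
  simp [inner_self_eq_norm_sq_to_K, hx]

/-- The hypothesis makes `A` determined by `A x`, self-adjointness puts `A x` on the line of `x`,
and the trace fixes the eigenvalue at `1`. -/
theorem eq_rankOne_of_forall_orthogonal {A : H →L[ℂ] H} (hA : A ∈ stateSet H) {x : H}
    (hx : ‖x‖ = 1) (h : ∀ y, inner ℂ x y = 0 → A y = 0) : A = rankOne ℂ x x := by
  have hpos := (nonneg_iff_isPositive _).1 hA.1
  have h1 (y : H) : A y = inner ℂ x y • A x := by
    have := h _ (sub_inner_smul_orthogonal hx y)
    rwa [map_sub, map_smul, sub_eq_zero] at this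
  have h2 : A x = inner ℂ x (A x) • x := by
    rw [← sub_eq_zero, ← inner_self_eq_zero (𝕜 := ℂ)]
    set z := A x - inner ℂ x (A x) • x with hz
    have hxz : inner ℂ x z = 0 := sub_inner_smul_orthogonal hx _
    have : inner ℂ (A x) z = 0 := by rw [hpos.inner_left_eq_inner_right, h z hxz, inner_zero_right]
    conv_lhs => rw [hz, inner_sub_left, inner_smul_left]
    rw [← hz, this, hxz]
    simp
  have h3 : A = (inner ℂ x (A x) : ℂ) • rankOne ℂ x x := by
    ext y
    rw [h1 y, h2]
    simp only [smul_apply, rankOne_apply, smul_smul, inner_smul_right, inner_self_eq_norm_sq_to_K,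
      hx]
    simp [mul_comm]
  have h4 := (hasTrace_rankOne_self x).smul (inner ℂ x (A x))
  rw [← h3] at h4
  have h5 := h4.unique hA.2
  rw [hx] at h5
  rw [h3, show (inner ℂ x (A x) : ℂ) = 1 by simpa using h5, one_smul]

theorem isPureState_unitState {x : H} (hx : ‖x‖ = 1) : IsPureState (unitState x hx) := by
  refine ⟨(unitState x hx).2, ?_⟩
  rintro A hA B hB ⟨s, t, hs, ht, -, hst⟩
  refine eq_rankOne_of_forall_orthogonal hA hx fun y hy => ?_
  apply apply_eq_zero_of_re_inner_eq_zero hA.1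
  have h1 : inner ℂ ((s • A + t • B) y) y = 0 := by
    rw [hst]
    simp [unitState, rankOne_apply, hy]
  have h2 := congrArg Complex.re h1
  simp only [add_apply, smul_apply, inner_add_left, inner_ofReal_smul_left, Complex.add_re,
    Complex.re_ofReal_mul, Complex.zero_re] at h2
  have h3 := re_inner_apply_nonneg hA.1 y
  have h4 := re_inner_apply_nonneg hB.1 y
  have h5 : s * (inner ℂ (A y) y).re = 0 := by
    linarith [mul_nonneg hs.le h3, mul_nonneg ht.le h4]
  exact (mul_eq_zero.1 h5).resolve_left hs.ne'

theorem range_sqrt_unitState {x : H} (hx : ‖x‖ = 1) :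
    (CFC.sqrt (unitState x hx : H →L[ℂ] H)).range = Submodule.span ℂ {x} := by
  have : CFC.sqrt (unitState x hx : H →L[ℂ] H) = rankOne ℂ x x :=
    CFC.sqrt_unique (isIdempotentElem_rankOne_self hx) (rankOne_self_nonneg x)
  rw [this]
  ext y
  rw [Submodule.mem_span_singleton]
  constructor
  · rintro ⟨z, rfl⟩
    exact ⟨inner ℂ x z, by simp⟩
  · rintro ⟨c, rfl⟩
    exact ⟨c • x, by simp [inner_self_eq_norm_sq_to_K, hx]⟩

theorem stateSet_ne_zero (A : stateSet H) : (A : H →L[ℂ] H) ≠ 0 := by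
  intro h
  have h1 : HasTrace (0 : H →L[ℂ] H) 0 := fun ι e => by simp
  have h2 := A.2.2
  rw [h] at h2
  exact zero_ne_one (h1.unique h2)

theorem eq_unitState_of_range_sqrt_le {x : H} (hx : ‖x‖ = 1) (B : stateSet H)
    (h : (CFC.sqrt (B : H →L[ℂ] H)).range ≤ Submodule.span ℂ {x}) : B = unitState x hx := by
  refine Subtype.ext (eq_rankOne_of_forall_orthogonal B.2 hx fun y hy => ?_)
  have hS : (CFC.sqrt (B : H →L[ℂ] H)).IsPositive :=
    (nonneg_iff_isPositive _).1 (CFC.sqrt_nonneg _)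
  apply apply_eq_zero_of_re_inner_eq_zero B.2.1
  rw [← sqrt_comp_sqrt_apply B.2.1]
  obtain ⟨c, hc⟩ := Submodule.mem_span_singleton.1
    (h ⟨CFC.sqrt (B : H →L[ℂ] H) y, rfl⟩)
  have hc' : CFC.sqrt (B : H →L[ℂ] H) (CFC.sqrt (B : H →L[ℂ] H) y) = c • x := hc.symm
  rw [hc', inner_smul_left, hy]
  simp

theorem exists_unit_mem_range_sqrt (A : stateSet H) :
    ∃ x : H, ‖x‖ = 1 ∧ x ∈ (CFC.sqrt (A : H →L[ℂ] H)).range := by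
  obtain ⟨y, hy⟩ : ∃ y, (A : H →L[ℂ] H) y ≠ 0 := by
    by_contra! h
    exact stateSet_ne_zero A (ContinuousLinearMap.ext h)
  have hy' : CFC.sqrt (A : H →L[ℂ] H) y ≠ 0 := fun h0 => hy <| by
    rw [← sqrt_comp_sqrt_apply A.2.1, h0, map_zero]
  exact ⟨_, norm_smul_inv_norm (𝕜 := ℂ) hy', Submodule.smul_mem _ _ ⟨y, rfl⟩⟩

/-- The right-hand side encodes minimality of `ran A^{1/2}` using only zeros of `C`, so it is
invariant under `φ`. If `ran B^{1/2}` leaves the line of `x`, the projection onto a vector outside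
that line separates `B` from `A`. Conversely, the projection onto any unit vector of `ran A^{1/2}`
is a competitor, which must equal `A`. -/
theorem exists_eq_unitState_iff {C : stateSet H → stateSet H → ℝ} (hC : IsCompatibilityLike C)
    (A : stateSet H) : (∃ x, ∃ hx : ‖x‖ = 1, A = unitState x hx) ↔
      ∀ B : stateSet H, (∀ D, C A D = 0 → C B D = 0) → B = A := by
  constructor
  · rintro ⟨x, hx, rfl⟩ B hB
    refine eq_unitState_of_range_sqrt_le hx B fun y hy => ?_
    by_contra hyx
    have hy0 : y ≠ 0 := by rintro rfl; exact hyx (zero_mem _)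
    set z := ((‖y‖⁻¹ : ℝ) : ℂ) • y with hzdef
    have hz : ‖z‖ = 1 := by simpa [hzdef] using norm_smul_inv_norm (𝕜 := ℂ) hy0
    have hyz : y = (‖y‖ : ℂ) • z := by
      rw [hzdef, smul_smul]
      simp [hy0]
    have hzx : z ∉ Submodule.span ℂ {x} := fun h => hyx (hyz ▸ Submodule.smul_mem _ _ h)
    have h1 : C (unitState x hx) (unitState z hz) = 0 := by
      rw [hC.eq_zero_iff, range_sqrt_unitState, range_sqrt_unitState, eq_bot_iff]
      rintro w ⟨hwx, hwz⟩
      obtain ⟨c, rfl⟩ := Submodule.mem_span_singleton.1 hwz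
      by_cases hc : c = 0
      · simp [hc]
      · exact absurd ((Submodule.smul_mem_iff _ hc).1 hwx) hzx
    have h2 := (hC.eq_zero_iff _ _).1 (hB _ h1)
    rw [range_sqrt_unitState] at h2
    have : z ∈ (⊥ : Submodule ℂ H) := h2 ▸
      ⟨Submodule.smul_mem _ _ hy, Submodule.mem_span_singleton_self z⟩
    rw [Submodule.mem_bot] at this
    simp [this] at hz
  · intro h
    obtain ⟨x, hx, hxA⟩ := exists_unit_mem_range_sqrt A
    refine ⟨x, hx, (h _ fun D hD => ?_).symm⟩
    rw [hC.eq_zero_iff] at hD ⊢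
    rw [range_sqrt_unitState, eq_bot_iff, ← hD]
    exact inf_le_inf_right _ ((Submodule.span_singleton_le_iff_mem _ _).2 hxA)

theorem exists_eq_unitState_map_iff {C : stateSet H → stateSet H → ℝ}
    (hC : IsCompatibilityLike C) {φ : stateSet H → stateSet H} (hφ : Function.Bijective φ)
    (hpres : ∀ A B : stateSet H, C (φ A) (φ B) = C A B) (A : stateSet H) :
    (∃ x, ∃ hx : ‖x‖ = 1, φ A = unitState x hx) ↔ ∃ x, ∃ hx : ‖x‖ = 1, A = unitState x hx := by
  rw [exists_eq_unitState_iff hC, exists_eq_unitState_iff hC, hφ.2.forall]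
  refine forall_congr' fun B => ?_
  rw [hφ.2.forall, hφ.1.eq_iff]
  simp_rw [hpres]

end PositiveOperators

/-! ### Strength of a state along a line -/

section StrengthAlong

open InnerProductSpace ContinuousLinearMap
open scoped ComplexOrder

variable {H : Type u} [NormedAddCommGroup H] [InnerProductSpace ℂ H] [CompleteSpace H]

/-- The strength of the operator `A` along the line spanned by the unit vector `x`. -/
noncomputable def strengthAlong (A : H →L[ℂ] H) (x : H) : ℝ :=
  sSup {r : ℝ | r ∈ Set.Icc (0 : ℝ) 1 ∧ r • rankOne ℂ x x ≤ A}

omit [CompleteSpace H] in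
theorem strengthAlong_nonneg (A : H →L[ℂ] H) (x : H) : 0 ≤ strengthAlong A x :=
  Real.sSup_nonneg fun _ hr => hr.1.1

theorem strengthAlong_mul_le {A : H →L[ℂ] H} (hA : 0 ≤ A) (x y : H) :
    strengthAlong A x * ‖inner ℂ x y‖ ^ 2 ≤ (inner ℂ (A y) y).re := by
  have hq := re_inner_apply_nonneg hA y
  rcases eq_or_ne (inner ℂ x y) 0 with h | h
  · simpa [h] using hq
  have hpos : 0 < ‖inner ℂ x y‖ ^ 2 := by positivity
  rw [← le_div_iff₀ hpos]
  refine Real.sSup_le (fun r hr => ?_) (by positivity)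
  rw [le_div_iff₀ hpos]
  exact (smul_rankOne_le_iff hA x r).1 hr.2 y

theorem le_strengthAlong {A : H →L[ℂ] H} (hA : A ∈ stateSet H) {x : H} (hx : ‖x‖ = 1) {r : ℝ}
    (hr : 0 ≤ r) (h : ∀ y, r * ‖inner ℂ x y‖ ^ 2 ≤ (inner ℂ (A y) y).re) :
    r ≤ strengthAlong A x := by
  refine le_csSup ⟨1, fun _ hs => hs.1.2⟩ ⟨⟨hr, ?_⟩, (smul_rankOne_le_iff hA.1 x r).2 h⟩
  have := (h x).trans (re_inner_apply_le_one hA hx)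
  simpa [inner_self_eq_norm_sq_to_K, hx] using this

/-- Cauchy–Schwarz for the form of `A`, `|⟨A y, z⟩|² ≤ ⟨A y, y⟩ ⟨A z, z⟩`, gives the lower bound;
its equality case `z = y` gives the upper one. -/
theorem strengthAlong_apply {A : H →L[ℂ] H} (hA : A ∈ stateSet H) {y : H} (hy : ‖A y‖ = 1) :
    strengthAlong A (A y) = (inner ℂ (A y) y).re⁻¹ := by
  set q := (inner ℂ (A y) y).re with hq
  have hq0 : 0 < q := by
    refine (re_inner_apply_nonneg hA.1 y).lt_of_ne fun h => ?_
    rw [apply_eq_zero_of_re_inner_eq_zero hA.1 h.symm, norm_zero] at hy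
    exact zero_ne_one hy
  have hqq : ‖inner ℂ (A y) y‖ = q := by
    rw [inner_apply_eq_ofReal hA.1, Complex.norm_real, Real.norm_of_nonneg hq0.le]
  apply le_antisymm
  · have := strengthAlong_mul_le hA.1 (A y) y
    rw [hqq, ← hq, sq, ← mul_assoc] at this
    rw [← one_div, le_div_iff₀ hq0]
    exact le_of_mul_le_mul_right (this.trans_eq (one_mul q).symm) hq0
  · refine le_strengthAlong hA hy (by positivity) fun z => ?_
    rw [inv_mul_le_iff₀ hq0]
    exact norm_inner_apply_sq_le hA.1 y z

omit [CompleteSpace H] in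
theorem strengthAlong_smul (A : H →L[ℂ] H) {c : ℂ} (hc : ‖c‖ = 1) (x : H) :
    strengthAlong A (c • x) = strengthAlong A x := by
  have : rankOne ℂ (c • x) (c • x) = rankOne ℂ x x := by
    ext y
    simp only [rankOne_apply, inner_smul_left, smul_smul]
    congr 1
    have : starRingEnd ℂ c * c = 1 := by rw [RCLike.conj_mul, hc]; simp
    linear_combination inner ℂ x y * this
  rw [strengthAlong, this, strengthAlong]

/-- The quadratic form of a state is recovered from its strength function. -/
theorem exists_strengthAlong_mul_eq {A : H →L[ℂ] H} (hA : A ∈ stateSet H) {y : H} (hy : A y ≠ 0) :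
    ∃ c : ℂ, ‖c • A y‖ = 1 ∧ 0 < strengthAlong A (c • A y) ∧
      strengthAlong A (c • A y) * ‖inner ℂ (c • A y) y‖ ^ 2 = (inner ℂ (A y) y).re := by
  have hn : ‖A y‖ ≠ 0 := norm_ne_zero_iff.2 hy
  have hq0 : 0 < (inner ℂ (A y) y).re :=
    (re_inner_apply_nonneg hA.1 y).lt_of_ne fun h =>
      hy (apply_eq_zero_of_re_inner_eq_zero hA.1 h.symm)
  set c : ℂ := ((‖A y‖⁻¹ : ℝ) : ℂ) with hc
  have h1 : ‖c • A y‖ = 1 := by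
    rw [norm_smul, hc, Complex.norm_real, norm_inv, norm_norm, inv_mul_cancel₀ hn]
  have h2 : strengthAlong A (c • A y) = (‖A y‖⁻¹ ^ 2 * (inner ℂ (A y) y).re)⁻¹ := by
    have := strengthAlong_apply hA (y := c • y) (by rwa [map_smul])
    rw [map_smul] at this
    rw [this, inner_smul_left, inner_smul_right, hc, Complex.conj_ofReal, Complex.re_ofReal_mul,
      Complex.re_ofReal_mul]
    ring
  refine ⟨c, h1, by rw [h2]; positivity, ?_⟩
  rw [h2, inner_smul_left, norm_mul, RCLike.norm_conj, inner_apply_eq_ofReal hA.1, hc,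
    Complex.norm_real, Complex.norm_real, norm_inv, norm_norm, Real.norm_of_nonneg hq0.le]
  simp only [Complex.ofReal_re]
  field_simp

/-- The form at `y` is a maximum of strengths weighted by `|⟨x, y⟩|²`, so a comparison of strengths
passes to forms. No linearity of `g` is needed. -/
theorem re_inner_apply_le_of_strengthAlong_le {A B : H →L[ℂ] H} (hA : A ∈ stateSet H)
    (hB : 0 ≤ B) {g : H → H} {y z : H}
    (hg : ∀ x, ‖x‖ = 1 → strengthAlong A x ≤ strengthAlong B (g x))
    (hyz : ∀ x, ‖inner ℂ (g x) z‖ = ‖inner ℂ x y‖) :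
    (inner ℂ (A y) y).re ≤ (inner ℂ (B z) z).re := by
  rcases eq_or_ne (A y) 0 with h | h
  · rw [h, inner_zero_left]
    exact re_inner_apply_nonneg hB z
  obtain ⟨c, hc, -, heq⟩ := exists_strengthAlong_mul_eq hA h
  rw [← heq, ← hyz]
  exact (mul_le_mul_of_nonneg_right (hg _ hc) (by positivity)).trans (strengthAlong_mul_le hB _ _)

/-! ### States of rank two -/

/-- The operator with eigenvalues `2/3` along `p` and `1/3` along `q`. -/
noncomputable def pairOperator (p q : H) : H →L[ℂ] H :=
  (2 / 3 : ℝ) • rankOne ℂ p p + (1 / 3 : ℝ) • rankOne ℂ q q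

omit [CompleteSpace H] in
theorem pairOperator_apply (p q y : H) :
    pairOperator p q y = (2 / 3 * inner ℂ p y : ℂ) • p + (1 / 3 * inner ℂ q y : ℂ) • q := by
  simp only [pairOperator, add_apply, smul_apply, rankOne_apply, ← Complex.coe_smul, smul_smul]
  push_cast
  rfl

theorem pairOperator_mem_stateSet {p q : H} (hp : ‖p‖ = 1) (hq : ‖q‖ = 1) :
    pairOperator p q ∈ stateSet H := by
  constructor
  · exact add_nonneg (smul_nonneg (by norm_num) (rankOne_self_nonneg p))
      (smul_nonneg (by norm_num) (rankOne_self_nonneg q))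
  · have := ((rankOne_self_mem_stateSet hp).2.real_smul (2 / 3)).add
      ((rankOne_self_mem_stateSet hq).2.real_smul (1 / 3))
    rw [show ((2 / 3 : ℝ) : ℂ) * 1 + ((1 / 3 : ℝ) : ℂ) * 1 = 1 by push_cast; norm_num] at this
    exact this

omit [CompleteSpace H] in
theorem sub_sub_inner_smul_orthogonal {p q : H} (hp : ‖p‖ = 1) (hq : ‖q‖ = 1)
    (hpq : inner ℂ p q = 0) (y : H) :
    inner ℂ p (y - inner ℂ p y • p - inner ℂ q y • q) = 0 ∧
      inner ℂ q (y - inner ℂ p y • p - inner ℂ q y • q) = 0 := by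
  simp [inner_self_eq_norm_sq_to_K, hp, hq, hpq, inner_eq_zero_symm.1 hpq]

/-- The component of `r` orthogonal to `p` and `q` lies in the kernel, where a positive strength
leaves no room for it. -/
theorem eq_of_strengthAlong_pairOperator_ne_zero {p q : H} (hp : ‖p‖ = 1) (hq : ‖q‖ = 1)
    (hpq : inner ℂ p q = 0) {r : H} (h : strengthAlong (pairOperator p q) r ≠ 0) :
    r = inner ℂ p r • p + inner ℂ q r • q := by
  obtain ⟨h1, h2⟩ := sub_sub_inner_smul_orthogonal hp hq hpq r
  set z := r - inner ℂ p r • p - inner ℂ q r • q with hz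
  have h3 := strengthAlong_mul_le (pairOperator_mem_stateSet hp hq).1 r z
  rw [pairOperator_apply, h1, h2] at h3
  simp only [mul_zero, zero_smul, add_zero, inner_zero_left, Complex.zero_re] at h3
  have h4 : 0 < strengthAlong (pairOperator p q) r := (strengthAlong_nonneg _ _).lt_of_ne' h
  have h5 : inner ℂ r z = 0 := by
    have : ‖inner ℂ r z‖ ^ 2 ≤ 0 := by
      by_contra! hcon
      exact absurd h3 (mul_pos h4 hcon).not_ge
    simpa using le_antisymm this (by positivity)
  have h6 : z = 0 := by
    rw [← inner_self_eq_zero (𝕜 := ℂ)]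
    conv_lhs => rw [hz, inner_sub_left, inner_sub_left, inner_smul_left, inner_smul_left]
    rw [← hz, h1, h2, h5]
    simp
  rw [hz, sub_sub, sub_eq_zero] at h6
  exact h6

theorem strengthAlong_pairOperator {p q : H} (hp : ‖p‖ = 1) (hq : ‖q‖ = 1)
    (hpq : inner ℂ p q = 0) {r : H} (hr : ‖r‖ = 1) {a b : ℂ} (hab : r = a • p + b • q) :
    strengthAlong (pairOperator p q) r = (3 - 3 / 2 * ‖inner ℂ p r‖ ^ 2)⁻¹ := by
  have hqp := inner_eq_zero_symm.1 hpq
  have hpp : inner ℂ p p = 1 := by simp [inner_self_eq_norm_sq_to_K, hp]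
  have hqq : inner ℂ q q = 1 := by simp [inner_self_eq_norm_sq_to_K, hq]
  have hpr : inner ℂ p r = a := by
    rw [hab, inner_add_right, inner_smul_right, inner_smul_right, hpp, hpq]; simp
  have hnorm : ‖a‖ ^ 2 + ‖b‖ ^ 2 = 1 := by
    have h1 : inner ℂ r r = 1 := by simp [inner_self_eq_norm_sq_to_K, hr]
    rw [hab, inner_add_left, inner_add_right, inner_add_right] at h1
    simp only [inner_smul_left, inner_smul_right, hpp, hqq, hpq, hqp, mul_zero, mul_one, add_zero,
      zero_add] at h1
    rw [mul_comm, RCLike.conj_mul, mul_comm b, RCLike.conj_mul] at h1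
    apply Complex.ofReal_injective
    push_cast
    exact h1
  -- This is the preimage of `r` under the operator, whose eigenvalues on the plane are inverted to
  -- `3/2` and `3`.
  set y := (3 / 2 * a : ℂ) • p + (3 * b : ℂ) • q with hy
  have hAy : pairOperator p q y = r := by
    rw [pairOperator_apply, hy, hab]
    simp only [inner_add_right, inner_smul_right, hpp, hqq, hpq, hqp]
    congr 2 <;> ring
  have h2 := strengthAlong_apply (pairOperator_mem_stateSet hp hq) (y := y) (by rw [hAy, hr])
  rw [hAy] at h2
  rw [h2, hpr]
  congr 1
  have h3 : inner ℂ r y = ((3 / 2 * ‖a‖ ^ 2 + 3 * ‖b‖ ^ 2 : ℝ) : ℂ) := by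
    rw [hab, hy]
    simp only [inner_add_left, inner_add_right, inner_smul_left, inner_smul_right, hpp, hqq, hpq,
      hqp]
    have ha := RCLike.conj_mul a
    have hb := RCLike.conj_mul b
    push_cast
    linear_combination 3 / 2 * ha + 3 * hb
  rw [h3, Complex.ofReal_re]
  linarith

theorem strengthAlong_pairOperator_le {p q : H} (hp : ‖p‖ = 1) (hq : ‖q‖ = 1)
    (hpq : inner ℂ p q = 0) {r : H} (hr : ‖r‖ = 1) :
    strengthAlong (pairOperator p q) r ≤ 2 / 3 := by
  by_cases h : strengthAlong (pairOperator p q) r = 0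
  · rw [h]; norm_num
  rw [strengthAlong_pairOperator hp hq hpq hr
    (eq_of_strengthAlong_pairOperator_ne_zero hp hq hpq h)]
  have h1 : ‖inner ℂ p r‖ ≤ 1 := by simpa [hp, hr] using norm_inner_le_norm (𝕜 := ℂ) p r
  have h2 : ‖inner ℂ p r‖ ^ 2 ≤ 1 := pow_le_one₀ (norm_nonneg _) h1
  rw [inv_le_comm₀ (by linarith) (by norm_num)]
  linarith

theorem le_strengthAlong_pairOperator {p q : H} (hp : ‖p‖ = 1) (hq : ‖q‖ = 1)
    (hpq : inner ℂ p q = 0) {r : H} (hr : ‖r‖ = 1)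
    (h : strengthAlong (pairOperator p q) r ≠ 0) :
    1 / 3 ≤ strengthAlong (pairOperator p q) r := by
  rw [strengthAlong_pairOperator hp hq hpq hr
    (eq_of_strengthAlong_pairOperator_ne_zero hp hq hpq h)]
  have h1 : ‖inner ℂ p r‖ ≤ 1 := by simpa [hp, hr] using norm_inner_le_norm (𝕜 := ℂ) p r
  have h2 : ‖inner ℂ p r‖ ^ 2 ≤ 1 := pow_le_one₀ (norm_nonneg _) h1
  rw [le_inv_comm₀ (by norm_num) (by linarith)]
  linarith [sq_nonneg ‖inner ℂ p r‖]

/-- The operator `c - B` is positive and its form vanishes at `p`, so it kills `p`. -/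
theorem apply_eq_smul_of_forall_re_inner_le {B : H →L[ℂ] H} (hB : 0 ≤ B) {c : ℝ}
    (h : ∀ y, (inner ℂ (B y) y).re ≤ c * ‖y‖ ^ 2) {p : H}
    (hp : c * ‖p‖ ^ 2 ≤ (inner ℂ (B p) p).re) : B p = (c : ℂ) • p := by
  have key (y : H) : inner ℂ (((c : ℂ) • (1 : H →L[ℂ] H) - B) y) y
      = ((c * ‖y‖ ^ 2 - (inner ℂ (B y) y).re : ℝ) : ℂ) := by
    rw [sub_apply, inner_sub_left, smul_apply, inner_smul_left, inner_apply_eq_ofReal hB,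
      one_apply_eq_self, inner_self_eq_norm_sq_to_K, Complex.conj_ofReal]
    push_cast
    rfl
  have hre (y : H) : (inner ℂ (((c : ℂ) • (1 : H →L[ℂ] H) - B) y) y).re
      = c * ‖y‖ ^ 2 - (inner ℂ (B y) y).re := by rw [key]; exact Complex.ofReal_re _
  have hpos : 0 ≤ (c : ℂ) • (1 : H →L[ℂ] H) - B := by
    rw [nonneg_iff_isPositive, isPositive_iff_complex]
    refine fun y => ⟨?_, ?_⟩
    · rw [RCLike.re_eq_complex_re, hre]
      exact (key y).symm
    · rw [RCLike.re_eq_complex_re, hre]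
      exact sub_nonneg.2 (h y)
  have := apply_eq_zero_of_re_inner_eq_zero hpos (y := p) (by rw [hre]; linarith [h p])
  rw [sub_apply, sub_eq_zero] at this
  exact this.symm

/-- The upper bound makes `2/3` the top of the quadratic form, so `p` is an eigenvector. Any further
direction in the range carries mass at least `1/3`, so one such direction exhausts the trace. -/
theorem exists_eq_pairOperator {B : H →L[ℂ] H} (hB : B ∈ stateSet H) {p : H} (hp : ‖p‖ = 1)
    (hle : ∀ r, ‖r‖ = 1 → strengthAlong B r ≤ 2 / 3)
    (hge : ∀ r, ‖r‖ = 1 → strengthAlong B r ≠ 0 → 1 / 3 ≤ strengthAlong B r)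
    (hBp : strengthAlong B p = 2 / 3) :
    ∃ u : H, ‖u‖ = 1 ∧ inner ℂ p u = 0 ∧ B = pairOperator p u := by
  have hsymm := ((nonneg_iff_isPositive _).1 hB.1).inner_left_eq_inner_right
  have hself {x : H} (hx : ‖x‖ = 1) : strengthAlong B x ≤ (inner ℂ (B x) x).re := by
    have := strengthAlong_mul_le hB.1 x x
    simpa [inner_self_eq_norm_sq_to_K, hx] using this
  have hbound (y : H) : (inner ℂ (B y) y).re ≤ 2 / 3 * ‖y‖ ^ 2 := by
    rcases eq_or_ne (B y) 0 with h | h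
    · rw [h, inner_zero_left]
      simp
    obtain ⟨c, hc, -, heq⟩ := exists_strengthAlong_mul_eq hB h
    rw [← heq]
    have h1 : ‖inner ℂ (c • B y) y‖ ≤ ‖y‖ := by
      simpa only [hc, one_mul] using norm_inner_le_norm (𝕜 := ℂ) (c • B y) y
    gcongr
    exact hle _ hc
  have hBpp : B p = ((2 / 3 : ℝ) : ℂ) • p :=
    apply_eq_smul_of_forall_re_inner_le hB.1 hbound (by
      rw [hp, ← hBp]; simpa using hself hp)
  have hp0 : p ≠ 0 := by rw [← norm_ne_zero_iff, hp]; exact one_ne_zero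
  -- Otherwise `B` would be the projection onto `p`, with eigenvalue `1` instead of `2/3`.
  obtain ⟨y, hpy, hy⟩ : ∃ y, inner ℂ p y = 0 ∧ B y ≠ 0 := by
    by_contra! hcon
    have h1 := eq_rankOne_of_forall_orthogonal hB hp hcon
    rw [h1, rankOne_apply, inner_self_eq_norm_sq_to_K, hp] at hBpp
    have h2 := smul_left_injective ℂ hp0 hBpp
    norm_num at h2
  obtain ⟨c, hu, hpos, -⟩ := exists_strengthAlong_mul_eq hB hy
  set u := c • B y with hudef
  have hpB (z : H) : inner ℂ p (B z) = 2 / 3 * inner ℂ p z := by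
    rw [← hsymm, hBpp, inner_smul_left, Complex.conj_ofReal]
    push_cast
    rfl
  have hpu : inner ℂ p u = 0 := by rw [hudef, inner_smul_right, hpB, hpy]; simp
  clear_value u
  have hp23 : 2 / 3 ≤ (inner ℂ (B p) p).re := hBp ▸ hself hp
  have hu13 : 1 / 3 ≤ (inner ℂ (B u) u).re := (hge u hu hpos.ne').trans (hself hu)
  -- The masses along `p` and `u` already add up to the whole trace.
  have hzero (z : H) (hpz : inner ℂ p z = 0) (huz : inner ℂ u z = 0) : B z = 0 := by
    by_contra hz
    have hz0 : z ≠ 0 := by rintro rfl; exact hz (map_zero B)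
    set d : ℂ := ((‖z‖⁻¹ : ℝ) : ℂ) with hd
    have hd0 : d ≠ 0 := by simpa [hd] using hz0
    have h1 := re_inner_apply_add_add_le_one hB hp hu (z := d • z)
      (by simpa [hd] using norm_smul_inv_norm (𝕜 := ℂ) hz0) hpu
      (by rw [inner_smul_right, hpz, mul_zero]) (by rw [inner_smul_right, huz, mul_zero])
    have h2 : (inner ℂ (B (d • z)) (d • z)).re = 0 :=
      le_antisymm (by linarith) (re_inner_apply_nonneg hB.1 _)
    have h3 := apply_eq_zero_of_re_inner_eq_zero hB.1 h2
    rw [map_smul] at h3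
    exact hz ((smul_eq_zero.1 h3).resolve_left hd0)
  have huB : inner ℂ u (B u) = (1 / 3 : ℂ) := by
    rw [← hsymm, inner_apply_eq_ofReal hB.1]
    have := re_inner_apply_add_le_one hB hp hu hpu
    rw [show (inner ℂ (B u) u).re = 1 / 3 by linarith]
    norm_num
  have hBu : B u = (1 / 3 : ℂ) • u := by
    obtain ⟨h1, h2⟩ := sub_sub_inner_smul_orthogonal hp hu hpu (B u)
    have h3 := hzero _ h1 h2
    rw [hpB, hpu, huB, mul_zero, zero_smul, sub_zero] at h1 h2 h3
    rw [← sub_eq_zero, ← inner_self_eq_zero (𝕜 := ℂ), inner_sub_left, hsymm, h3,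
      inner_smul_left, h2]
    simp
  refine ⟨u, hu, hpu, ?_⟩
  ext y
  obtain ⟨h1, h2⟩ := sub_sub_inner_smul_orthogonal hp hu hpu y
  have h3 := hzero _ h1 h2
  rw [map_sub, map_sub, map_smul, map_smul, hBpp, hBu, sub_sub, sub_eq_zero] at h3
  rw [h3, pairOperator_apply, smul_smul, smul_smul]
  push_cast
  congr 2 <;> ring

end StrengthAlong

/-! ### Wigner's theorem -/

section Wigner

variable {H : Type u} [NormedAddCommGroup H] [InnerProductSpace ℂ H]

/-- A map preserving real parts of inner products on an additive subgroup is additive there. -/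
theorem map_add_of_re_inner_eq {K : AddSubgroup H} {V : H → H}
    (hV : ∀ x ∈ K, ∀ y ∈ K, (inner ℂ (V x) (V y)).re = (inner ℂ x y).re) {x y : H} (hx : x ∈ K)
    (hy : y ∈ K) : V (x + y) = V x + V y := by
  have hxy := K.add_mem hx hy
  -- The squared norm of `V (x + y) - V x - V y` expands into real parts of inner products, so it
  -- equals the same expression without `V`, which is zero.
  rw [← sub_eq_zero, ← inner_self_eq_zero (𝕜 := ℂ)]
  apply Complex.ext
  · have hs (a b : H) : (inner ℂ a b).re = (inner ℂ b a).re := inner_re_symm (𝕜 := ℂ) a b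
    simp only [inner_sub_left, inner_sub_right, inner_add_left, inner_add_right, Complex.sub_re,
      Complex.add_re, hV _ hx _ hx, hV _ hx _ hy, hV _ hy _ hx, hV _ hy _ hy, hV _ hxy _ hxy,
      hV _ hxy _ hx, hV _ hxy _ hy, hV _ hx _ hxy, hV _ hy _ hxy, Complex.zero_re]
    ring
  · exact inner_self_im (𝕜 := ℂ) _

/-- If `‖a‖ = ‖b‖` and `‖1 + a‖ = ‖1 + b‖` then the complex numbers `a` and `b` have the same real
part. -/
theorem Complex.re_eq_of_norm_eq {a b : ℂ} (h : ‖a‖ = ‖b‖) (h1 : ‖1 + a‖ = ‖1 + b‖) :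
    a.re = b.re := by
  have h2 : ‖a‖ ^ 2 = ‖b‖ ^ 2 := by rw [h]
  have h3 : ‖1 + a‖ ^ 2 = ‖1 + b‖ ^ 2 := by rw [h1]
  rw [← Complex.normSq_eq_norm_sq, ← Complex.normSq_eq_norm_sq, Complex.normSq_apply,
    Complex.normSq_apply] at h2 h3
  simp at h3
  linarith

/-- Two vectors saturating the Cauchy-Schwarz inequality with equal norms and purely imaginary
inner product differ by a factor `± I`. -/
theorem eq_I_smul_or_eq_neg_I_smul {a b : H} (hn : ‖a‖ = ‖b‖) (hre : (inner ℂ a b).re = 0)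
    (hab : ‖inner ℂ a b‖ = ‖a‖ * ‖b‖) : b = Complex.I • a ∨ b = -(Complex.I • a) := by
  rcases eq_or_ne a 0 with rfl | ha
  · left
    rw [smul_zero, ← norm_eq_zero, ← hn, norm_zero]
  have hb : b ≠ 0 := by rwa [← norm_ne_zero_iff, ← hn, norm_ne_zero_iff]
  obtain ⟨r, -, rfl⟩ := (norm_inner_eq_norm_iff ha hb).1 hab
  have ha' : ‖a‖ ^ 2 ≠ 0 := by positivity
  have hr : r.re = 0 := by
    rw [inner_smul_right, inner_self_eq_norm_sq_to_K] at hre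
    have : (r * ((‖a‖ ^ 2 : ℝ) : ℂ)).re = 0 := by push_cast; exact hre
    rw [Complex.re_mul_ofReal] at this
    exact (mul_eq_zero.1 this).resolve_right ha'
  have hnr : ‖r‖ = 1 := by
    rw [norm_smul] at hn
    have : ‖a‖ ≠ 0 := by positivity
    field_simp at hn
    exact hn.symm
  have hi : r.im ^ 2 = 1 := by
    have := Complex.sq_norm r
    rw [Complex.normSq_apply, hr, hnr] at this
    linarith
  have hrI : r = r.im * Complex.I := by
    apply Complex.ext <;> simp [hr]
  rcases (sq_eq_sq_iff_eq_or_eq_neg.1 (hi.trans (one_pow 2).symm)) with h | h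
  · left; rw [hrI, h]; simp
  · right; rw [hrI, h]; simp

/-- Equality in Cauchy–Schwarz gives `V (i x) = ± i V x` for each `x`; additivity excludes different
signs at two vectors, since `x + y` would have to match both. -/
theorem map_I_smul_of_norm_inner_eq {K : Submodule ℂ H} {V : H → H}
    (hre : ∀ x ∈ K, ∀ y ∈ K, (inner ℂ (V x) (V y)).re = (inner ℂ x y).re)
    (hnorm : ∀ x ∈ K, ∀ y ∈ K, ‖inner ℂ (V x) (V y)‖ = ‖inner ℂ x y‖) :
    (∀ x ∈ K, V (Complex.I • x) = Complex.I • V x) ∨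
      (∀ x ∈ K, V (Complex.I • x) = -(Complex.I • V x)) := by
  have hadd {x y : H} (hx : x ∈ K) (hy : y ∈ K) : V (x + y) = V x + V y :=
    map_add_of_re_inner_eq (K := K.toAddSubgroup) hre hx hy
  have hn {x : H} (hx : x ∈ K) : ‖V x‖ = ‖x‖ := by
    have := hre x hx x hx
    have h2 (z : H) : (inner ℂ z z).re = ‖z‖ ^ 2 := inner_self_eq_norm_sq (𝕜 := ℂ) z
    rw [h2, h2] at this
    exact (sq_eq_sq₀ (norm_nonneg _) (norm_nonneg _)).1 this
  have hI {x : H} (hx : x ∈ K) : Complex.I • x ∈ K := K.smul_mem _ hx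
  have hor {x : H} (hx : x ∈ K) :
      V (Complex.I • x) = Complex.I • V x ∨ V (Complex.I • x) = -(Complex.I • V x) := by
    apply eq_I_smul_or_eq_neg_I_smul
    · rw [hn hx, hn (hI hx), norm_smul]; simp
    · rw [hre x hx _ (hI hx), inner_smul_right, inner_self_eq_norm_sq_to_K]
      have : Complex.I * (‖x‖ : ℂ) ^ 2 = ((‖x‖ ^ 2 : ℝ) : ℂ) * Complex.I := by
        push_cast; ring
      erw [this, Complex.re_ofReal_mul]
      simp
    · rw [hnorm x hx _ (hI hx), hn hx, hn (hI hx), inner_smul_right, norm_smul,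
        inner_self_eq_norm_sq_to_K]
      simp [sq]
  by_contra! hcon
  obtain ⟨⟨x, hx, hx'⟩, y, hy, hy'⟩ := hcon
  have hx2 := (hor hx).resolve_left hx'
  have hy2 := (hor hy).resolve_right hy'
  have hxy := hor (K.add_mem hx hy)
  rw [smul_add, hadd (hI hx) (hI hy), hadd hx hy, smul_add, hx2, hy2] at hxy
  rcases hxy with h | h
  · apply hx'
    rw [hx2]
    exact add_right_cancel h
  · apply hy'
    rw [hy2]
    rw [neg_add] at h
    exact add_left_cancel h

theorem map_real_smul_of_re_inner_eq {K : Submodule ℂ H} {V : H → H}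
    (hV : ∀ x ∈ K, ∀ y ∈ K, (inner ℂ (V x) (V y)).re = (inner ℂ x y).re) {x : H} (hx : x ∈ K)
    (t : ℝ) : V ((t : ℂ) • x) = (t : ℂ) • V x := by
  have htx := K.smul_mem (t : ℂ) hx
  rw [← sub_eq_zero, ← inner_self_eq_zero (𝕜 := ℂ)]
  apply Complex.ext
  · simp only [inner_sub_left, inner_sub_right, inner_smul_left, inner_smul_right, Complex.sub_re,
      Complex.conj_ofReal, Complex.re_ofReal_mul, hV _ htx _ htx, hV _ htx _ hx, hV _ hx _ htx,
      hV _ hx _ hx, Complex.zero_re]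
    ring
  · exact inner_self_im (𝕜 := ℂ) _

/-- A map preserving real parts and moduli of inner products on a complex subspace is there either
complex homogeneous or conjugate homogeneous. -/
theorem map_smul_of_norm_inner_eq {K : Submodule ℂ H} {V : H → H}
    (hre : ∀ x ∈ K, ∀ y ∈ K, (inner ℂ (V x) (V y)).re = (inner ℂ x y).re)
    (hnorm : ∀ x ∈ K, ∀ y ∈ K, ‖inner ℂ (V x) (V y)‖ = ‖inner ℂ x y‖) :
    (∀ (c : ℂ), ∀ x ∈ K, V (c • x) = c • V x) ∨
      (∀ (c : ℂ), ∀ x ∈ K, V (c • x) = starRingEnd ℂ c • V x) := by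
  have key (c : ℂ) (x : H) (hx : x ∈ K) :
      V (c • x) = (c.re : ℂ) • V x + (c.im : ℂ) • V (Complex.I • x) := by
    have hI := K.smul_mem Complex.I hx
    conv_lhs => rw [← Complex.re_add_im c, add_smul, mul_smul]
    rw [map_add_of_re_inner_eq (K := K.toAddSubgroup) hre (K.smul_mem _ hx) (K.smul_mem _ hI),
      map_real_smul_of_re_inner_eq hre hx, map_real_smul_of_re_inner_eq hre hI]
  rcases map_I_smul_of_norm_inner_eq hre hnorm with h | h
  · left
    intro c x hx
    rw [key c x hx, h x hx, smul_smul, ← add_smul, Complex.re_add_im]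
  · right
    intro c x hx
    rw [key c x hx, h x hx, smul_neg, smul_smul, ← sub_eq_add_neg, ← sub_smul]
    congr 1
    apply Complex.ext <;> simp

/-- Extension of a semilinear isometry between hyperplanes to the whole space, and its relation to
a ray map `f` which induces it. -/
theorem exists_linearIsometryEquiv_of_orthogonal (σ : ℂ →+* ℂ) [RingHomInvPair σ σ]
    (hσ : ∀ z, ‖σ z‖ = ‖z‖) {f V : H → H} {e e' : H} (he : ‖e‖ = 1) (he' : ‖e'‖ = 1)
    (hadd : ∀ x y, inner ℂ e x = 0 → inner ℂ e y = 0 → V (x + y) = V x + V y)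
    (hsmul : ∀ (c : ℂ) (x : H), inner ℂ e x = 0 → V (c • x) = σ c • V x)
    (hVn : ∀ x, inner ℂ e x = 0 → ‖V x‖ = ‖x‖)
    (hVe : ∀ x, inner ℂ e x = 0 → inner ℂ e' (V x) = 0)
    (hf0 : ∀ x, inner ℂ e x = 0 → ∃ c : ℂ, f x = c • V x)
    (hf1 : ∀ x, inner ℂ e x = 0 → ∃ c : ℂ, f (e + x) = c • (e' + V x))
    (hfs : ∀ (a : ℂ) x, ∃ c : ℂ, f (a • x) = c • f x)
    (hsurj : ∀ y, ∃ x, ∃ c : ℂ, y = c • f x) :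
    ∃ U : H ≃ₛₗᵢ[σ] H, ∀ x, ∃ c : ℂ, f x = c • U x := by
  have horth (y : H) : inner ℂ e (y - inner ℂ e y • e) = 0 := by
    simp [inner_self_eq_norm_sq_to_K, he]
  let U₀ : H →ₛₗ[σ] H :=
    { toFun := fun y => σ (inner ℂ e y) • e' + V (y - inner ℂ e y • e)
      map_add' := fun x y => by
        rw [← add_add_add_comm, ← add_smul, ← map_add, ← hadd _ _ (horth x) (horth y),
          inner_add_right, add_smul]
        congr 2
        abel
      map_smul' := fun c x => by
        rw [smul_add, smul_smul, ← map_mul, ← hsmul _ _ (horth x), inner_smul_right, smul_sub,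
          smul_smul] }
  have hU₀ (y : H) : U₀ y = σ (inner ℂ e y) • e' + V (y - inner ℂ e y • e) := rfl
  let U₁ : H →ₛₗᵢ[σ] H :=
    { U₀ with
      norm_map' := fun y => by
        change ‖U₀ y‖ = ‖y‖
        rw [hU₀, ← sq_eq_sq₀ (norm_nonneg _) (norm_nonneg _), sq, sq,
          norm_add_sq_eq_norm_sq_add_norm_sq_of_inner_eq_zero (𝕜 := ℂ) _ _
            (by rw [inner_smul_left, hVe _ (horth y), mul_zero]), hVn _ (horth y), norm_smul, hσ,
          he']
        conv_rhs => rw [← add_sub_cancel (inner ℂ e y • e) y]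
        rw [norm_add_sq_eq_norm_sq_add_norm_sq_of_inner_eq_zero (𝕜 := ℂ) _ _
            (by rw [inner_smul_left, horth y, mul_zero]), norm_smul, he] }
  have hU₁ (y : H) : U₁ y = σ (inner ℂ e y) • e' + V (y - inner ℂ e y • e) := rfl
  have hray (y : H) : ∃ c : ℂ, f y = c • U₁ y := by
    by_cases ha : inner ℂ e y = 0
    · obtain ⟨c, hc⟩ := hf0 y ha
      refine ⟨c, ?_⟩
      rw [hc, hU₁, ha]
      simp
    -- A vector with nonzero component along `e` is rescaled to have component `1`, the form covered
    -- by `hf1`.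
    · set a := inner ℂ e y with hadef
      set x := y - a • e with hx
      have hxe : inner ℂ e x = 0 := horth y
      have hy : y = a • (e + a⁻¹ • x) := by
        rw [smul_add, smul_inv_smul₀ ha, hx]
        abel
      obtain ⟨c, hc⟩ := hfs a (e + a⁻¹ • x)
      obtain ⟨d, hd⟩ := hf1 (a⁻¹ • x) (by rw [inner_smul_right, hxe, mul_zero])
      have hσa : σ a ≠ 0 := (map_ne_zero σ).2 ha
      refine ⟨c * d * (σ a)⁻¹, ?_⟩
      rw [hU₁, ← hadef, ← hx, hy, hc, hd, hsmul _ _ hxe, map_inv₀, mul_smul, mul_smul,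
        smul_add (σ a)⁻¹, smul_smul (σ a)⁻¹ (σ a), inv_mul_cancel₀ hσa, one_smul]
  refine ⟨LinearIsometryEquiv.ofSurjective U₁ fun y => ?_, hray⟩
  obtain ⟨x, c, rfl⟩ := hsurj y
  obtain ⟨d, hd⟩ := hray x
  -- `σ` is its own inverse, so `U₁` turns this scalar back into `c * d`.
  refine ⟨σ (c * d) • x, ?_⟩
  rw [map_smulₛₗ, RingHomInvPair.comp_apply_eq, hd, smul_smul]

/-- **Wigner's theorem** for maps between vectors that preserve moduli of inner products. -/
theorem wigner {f : H → H} (hf : ∀ x y, ‖inner ℂ (f x) (f y)‖ = ‖inner ℂ x y‖)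
    (hsurj : ∀ y, ∃ x, ∃ c : ℂ, y = c • f x) :
    (∃ U : H ≃ₗᵢ[ℂ] H, ∀ x, ∃ c : ℂ, f x = c • U x) ∨
      (∃ U : H ≃ₛₗᵢ[starRingEnd ℂ] H, ∀ x, ∃ c : ℂ, f x = c • U x) := by
  rcases subsingleton_or_nontrivial H with hH | hH
  · exact Or.inl ⟨.refl ℂ H, fun x => ⟨1, Subsingleton.elim _ _⟩⟩
  obtain ⟨e, he⟩ := exists_norm_eq H zero_le_one
  have hfn (x : H) : ‖f x‖ = ‖x‖ := by
    have := hf x x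
    rw [inner_self_eq_norm_sq_to_K, inner_self_eq_norm_sq_to_K] at this
    simpa using this
  have hf0 (x : H) (hx : x ≠ 0) : f x ≠ 0 := by rwa [← norm_ne_zero_iff, hfn, norm_ne_zero_iff]
  have hfs (a : ℂ) (x : H) : ∃ c : ℂ, f (a • x) = c • f x := by
    by_cases hax : a • x = 0
    · refine ⟨0, ?_⟩
      rw [zero_smul, ← norm_eq_zero, hfn, hax, norm_zero]
    · obtain ⟨ha, hx⟩ := smul_ne_zero_iff.1 hax
      obtain ⟨c, -, hc⟩ := (norm_inner_eq_norm_iff (hf0 _ hx) (hf0 _ hax)).1 (by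
        rw [hf, hfn, hfn, inner_smul_right, inner_self_eq_norm_sq_to_K, norm_smul]
        simp
        ring)
      exact ⟨c, hc⟩
  have he' : ‖f e‖ = 1 := by rw [hfn, he]
  have hee : inner ℂ e e = 1 := by simp [inner_self_eq_norm_sq_to_K, he]
  have hee' : inner ℂ (f e) (f e) = 1 := by simp [inner_self_eq_norm_sq_to_K, he']
  -- For `x ⊥ e`, the phase of `f (e + x)` is fixed by making its component along `f e` equal to
  -- `1`; `V x` is the remainder, orthogonal to `f e`.
  let V : H → H := fun x => (inner ℂ (f e) (f (e + x)))⁻¹ • f (e + x) - f e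
  have hV (x : H) : f e + V x = (inner ℂ (f e) (f (e + x)))⁻¹ • f (e + x) :=
    add_sub_cancel _ _
  have hk (x : H) (hx : inner ℂ e x = 0) : ‖inner ℂ (f e) (f (e + x))‖ = 1 := by
    rw [hf, inner_add_right, hx, hee]
    simp
  have hk0 (x : H) (hx : inner ℂ e x = 0) : inner ℂ (f e) (f (e + x)) ≠ 0 := by
    rw [← norm_ne_zero_iff, hk x hx]
    exact one_ne_zero
  have hVe (x : H) (hx : inner ℂ e x = 0) : inner ℂ (f e) (V x) = 0 := by
    simp only [V]
    rw [inner_sub_right, inner_smul_right, inv_mul_cancel₀ (hk0 x hx), hee', sub_self]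
  -- Shifting by `e` supplies a second modulus; together with `|⟨x, y⟩|` it determines the real part
  -- of `⟨x, y⟩`.
  have hone (x y : H) (hx : inner ℂ e x = 0) (hy : inner ℂ e y = 0) :
      ‖1 + inner ℂ (V x) (V y)‖ = ‖1 + inner ℂ x y‖ := by
    have h1 : inner ℂ (f e + V x) (f e + V y) = 1 + inner ℂ (V x) (V y) := by
      rw [inner_add_left, inner_add_right, inner_add_right, hVe y hy, hee',
        inner_eq_zero_symm.1 (hVe x hx), add_zero, zero_add]
    have h2 : inner ℂ (e + x) (e + y) = 1 + inner ℂ x y := by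
      rw [inner_add_left, inner_add_right, inner_add_right, hy, hee, inner_eq_zero_symm.1 hx,
        add_zero, zero_add]
    rw [← h1, ← h2, hV, hV, inner_smul_left, inner_smul_right, norm_mul, norm_mul, RCLike.norm_conj,
      norm_inv, norm_inv, hk x hx, hk y hy, hf]
    simp
  have hVn (x : H) (hx : inner ℂ e x = 0) : ‖V x‖ = ‖x‖ := by
    have := hone x x hx hx
    have h2 (z : H) : ‖1 + inner ℂ z z‖ = 1 + ‖z‖ ^ 2 := by
      rw [inner_self_eq_norm_sq_to_K]
      have : (1 + (‖z‖ : ℂ) ^ 2) = ((1 + ‖z‖ ^ 2 : ℝ) : ℂ) := by push_cast; rfl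
      erw [this]
      rw [Complex.norm_real, Real.norm_of_nonneg (by positivity)]
    rw [h2, h2, add_right_inj] at this
    exact (sq_eq_sq₀ (norm_nonneg _) (norm_nonneg _)).1 this
  have hVf (x : H) (hx : inner ℂ e x = 0) : ∃ c : ℂ, ‖c‖ = 1 ∧ f x = c • V x := by
    by_cases hx0 : x = 0
    · refine ⟨1, norm_one, ?_⟩
      have h1 : V x = 0 := by rw [← norm_eq_zero, hVn x hx, hx0, norm_zero]
      rw [h1, smul_zero, ← norm_eq_zero, hfn, hx0, norm_zero]
    have hVx0 : V x ≠ 0 := by rwa [← norm_ne_zero_iff, hVn x hx, norm_ne_zero_iff]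
    have h0 : inner ℂ (f e) (f x) = 0 := by rw [← norm_eq_zero, hf, hx, norm_zero]
    -- As `f x ⊥ f e`, the modulus of `⟨V x, f x⟩` is that of `⟨e + x, x⟩`, namely `‖x‖²`: equality
    -- in Cauchy–Schwarz.
    obtain ⟨c, -, hc⟩ := (norm_inner_eq_norm_iff hVx0 (hf0 x hx0)).1 (by
      rw [← zero_add (inner ℂ (V x) (f x)), ← h0, ← inner_add_left, hV, inner_smul_left, norm_mul,
        RCLike.norm_conj, norm_inv, hk x hx, hf, inner_add_left, hx, hVn x hx, hfn,
        inner_self_eq_norm_sq_to_K]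
      simp [sq])
    refine ⟨c, ?_, hc⟩
    have h3 := hfn x
    rw [hc, norm_smul, hVn x hx] at h3
    exact mul_right_cancel₀ (norm_ne_zero_iff.2 hx0) (h3.trans (one_mul _).symm)
  have hnorm (x y : H) (hx : inner ℂ e x = 0) (hy : inner ℂ e y = 0) :
      ‖inner ℂ (V x) (V y)‖ = ‖inner ℂ x y‖ := by
    obtain ⟨c, hc, hcx⟩ := hVf x hx
    obtain ⟨d, hd, hdy⟩ := hVf y hy
    rw [← hf x y, hcx, hdy, inner_smul_left, inner_smul_right, norm_mul, norm_mul,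
      RCLike.norm_conj, hc, hd, one_mul, one_mul]
  let K : Submodule ℂ H := (Submodule.span ℂ {e})ᗮ
  have hK {x : H} : x ∈ K ↔ inner ℂ e x = 0 := Submodule.mem_orthogonal_singleton_iff_inner_right
  have hre : ∀ x ∈ K, ∀ y ∈ K, (inner ℂ (V x) (V y)).re = (inner ℂ x y).re := fun x hx y hy =>
    Complex.re_eq_of_norm_eq (hnorm x y (hK.1 hx) (hK.1 hy)) (hone x y (hK.1 hx) (hK.1 hy))
  have hadd (x y : H) (hx : inner ℂ e x = 0) (hy : inner ℂ e y = 0) : V (x + y) = V x + V y :=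
    map_add_of_re_inner_eq (K := K.toAddSubgroup) hre (hK.2 hx) (hK.2 hy)
  have hf1 (x : H) (hx : inner ℂ e x = 0) : ∃ c : ℂ, f (e + x) = c • (f e + V x) :=
    ⟨inner ℂ (f e) (f (e + x)), by rw [hV, smul_inv_smul₀ (hk0 x hx)]⟩
  have hf2 (x : H) (hx : inner ℂ e x = 0) : ∃ c : ℂ, f x = c • V x :=
    (hVf x hx).imp fun _ h => h.2
  refine (map_smul_of_norm_inner_eq hre fun x hx y hy => hnorm x y (hK.1 hx) (hK.1 hy)).imp
    (fun h => ?_) (fun h => ?_)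
  · exact exists_linearIsometryEquiv_of_orthogonal (RingHom.id ℂ) (fun _ => rfl) he he' hadd
      (fun c x hx => h c x (hK.2 hx)) hVn hVe hf2 hf1 hfs hsurj
  · exact exists_linearIsometryEquiv_of_orthogonal (starRingEnd ℂ) (fun z => RCLike.norm_conj z) he
      he' hadd (fun c x hx => h c x (hK.2 hx)) hVn hVe hf2 hf1 hfs hsurj

/-- Polarization gives the real part; replacing `y` by `i y` gives the imaginary part with its sign
reversed. -/
theorem inner_map_map_of_conj_linearIsometry (U : H →ₛₗᵢ[starRingEnd ℂ] H) (x y : H) :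
    inner ℂ (U x) (U y) = starRingEnd ℂ (inner ℂ x y) := by
  have hre (x y : H) : (inner ℂ (U x) (U y)).re = (inner ℂ x y).re := by
    have h (a b : H) : (inner ℂ a b).re = (‖a + b‖ * ‖a + b‖ - ‖a‖ * ‖a‖ - ‖b‖ * ‖b‖) / 2 :=
      re_inner_eq_norm_add_mul_self_sub_norm_mul_self_sub_norm_mul_self_div_two (𝕜 := ℂ) a b
    rw [h, h, ← map_add, U.norm_map, U.norm_map, U.norm_map]
  apply Complex.ext
  · rw [hre, Complex.conj_re]
  · have h := hre x (Complex.I • y)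
    rw [map_smulₛₗ, inner_smul_right, inner_smul_right] at h
    simp at h
    rw [Complex.conj_im, ← h]

end Wigner

/-! ### From compatibility preservers to Wigner symmetries -/

section CompatibilityPreservers

open InnerProductSpace ContinuousLinearMap

variable {H : Type u} [NormedAddCommGroup H] [InnerProductSpace ℂ H] [CompleteSpace H]

omit [CompleteSpace H] in
theorem exists_eq_smul_of_unitState_eq {x y : H} {hx : ‖x‖ = 1} {hy : ‖y‖ = 1}
    (h : unitState x hx = unitState y hy) : ∃ c : ℂ, ‖c‖ = 1 ∧ x = c • y := by
  have h1 := congrArg (fun A : stateSet H => (A : H →L[ℂ] H) x) h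
  simp only [unitState, rankOne_apply, inner_self_eq_norm_sq_to_K, hx] at h1
  have h2 : x = inner ℂ y x • y := by simpa using h1
  refine ⟨inner ℂ y x, ?_, h2⟩
  have h3 := congrArg norm h2
  rw [norm_smul, hx, hy, mul_one] at h3
  exact h3.symm

omit [CompleteSpace H] in
theorem exists_eq_norm_smul [Nontrivial H] (x : H) : ∃ u : H, ‖u‖ = 1 ∧ x = (‖x‖ : ℂ) • u := by
  rcases eq_or_ne x 0 with rfl | hx
  · obtain ⟨u, hu⟩ := exists_norm_eq H zero_le_one
    exact ⟨u, hu, by simp⟩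
  · refine ⟨((‖x‖⁻¹ : ℝ) : ℂ) • x, by simpa using norm_smul_inv_norm (𝕜 := ℂ) hx, ?_⟩
    rw [smul_smul]
    simp [hx]

theorem sq_apply_unitState {C : stateSet H → stateSet H → ℝ} (hC : IsCompatibilityLike C)
    (A : stateSet H) {x : H} (hx : ‖x‖ = 1) :
    C A (unitState x hx) ^ 2 = strengthAlong (A : H →L[ℂ] H) x :=
  hC.sq_eq_sSup A _ (isPureState_unitState hx)

section Preserver

variable {C : stateSet H → stateSet H → ℝ} (hC : IsCompatibilityLike C)
  {φ : stateSet H → stateSet H} (hφ : Function.Bijective φ)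
  (hpres : ∀ A B : stateSet H, C (φ A) (φ B) = C A B)

include hC hpres

theorem strengthAlong_map (A : stateSet H) {x x' : H} {hx : ‖x‖ = 1} {hx' : ‖x'‖ = 1}
    (h : φ (unitState x hx) = unitState x' hx') :
    strengthAlong (φ A : H →L[ℂ] H) x' = strengthAlong (A : H →L[ℂ] H) x := by
  rw [← sq_apply_unitState hC _ hx, ← sq_apply_unitState hC _ hx', ← h, hpres]

include hφ

theorem exists_map_unitState_eq {y : H} (hy : ‖y‖ = 1) :
    ∃ x, ∃ hx : ‖x‖ = 1, φ (unitState x hx) = unitState y hy := by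
  obtain ⟨A, hA⟩ := hφ.2 (unitState y hy)
  obtain ⟨x, hx, rfl⟩ := (exists_eq_unitState_map_iff hC hφ hpres A).1 ⟨y, hy, hA⟩
  exact ⟨x, hx, hA⟩

/-- Completing `p` to an orthonormal pair whose span contains `r`, one compares the strength of the
pair state along `r` with that of its image along `r'`; both are the same injective function of the
overlap. -/
theorem norm_inner_eq_of_map_unitState_eq {p r p' r' : H} {hp : ‖p‖ = 1} {hr : ‖r‖ = 1}
    {hp' : ‖p'‖ = 1} {hr' : ‖r'‖ = 1} (hpp' : φ (unitState p hp) = unitState p' hp')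
    (hrr' : φ (unitState r hr) = unitState r' hr') : ‖inner ℂ p' r'‖ = ‖inner ℂ p r‖ := by
  have horth := sub_inner_smul_orthogonal hp r
  rcases eq_or_ne (r - inner ℂ p r • p) 0 with h0 | h0
  · rw [sub_eq_zero] at h0
    have hc : ‖inner ℂ p r‖ = 1 := by
      have := congrArg norm h0
      rw [norm_smul, hp, hr, mul_one] at this
      exact this.symm
    have hst : unitState r hr = unitState p hp := by
      apply eq_unitState_of_range_sqrt_le
      rw [range_sqrt_unitState, Submodule.span_singleton_le_iff_mem, h0]
      exact Submodule.smul_mem _ _ (Submodule.mem_span_singleton_self p)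
    rw [hst, hpp'] at hrr'
    obtain ⟨c, hc', rfl⟩ := exists_eq_smul_of_unitState_eq hrr'
    rw [inner_smul_left, inner_self_eq_norm_sq_to_K, hr', hc]
    simp [hc']
  set z := r - inner ℂ p r • p with hz
  set q : H := ((‖z‖⁻¹ : ℝ) : ℂ) • z with hq
  have hqn : ‖q‖ = 1 := by simpa [hq] using norm_smul_inv_norm (𝕜 := ℂ) h0
  have hpq : inner ℂ p q = 0 := by rw [hq, inner_smul_right, horth, mul_zero]
  have hrq : r = inner ℂ p r • p + (‖z‖ : ℂ) • q := by
    rw [hq, smul_smul, Complex.ofReal_inv, mul_inv_cancel₀ (by simpa using h0), one_smul, hz,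
      add_sub_cancel]
  let A : stateSet H := ⟨pairOperator p q, pairOperator_mem_stateSet hp hqn⟩
  have hA {x x' : H} {hx : ‖x‖ = 1} {hx' : ‖x'‖ = 1} (h : φ (unitState x hx) = unitState x' hx') :
      strengthAlong (φ A : H →L[ℂ] H) x' = strengthAlong (pairOperator p q) x :=
    strengthAlong_map hC hpres A h
  -- Every unit vector represents the image of a pure state, so the bounds on strengths hold for `φ
  -- A` along all lines.
  obtain ⟨u, hu, hpu, hφA⟩ := exists_eq_pairOperator (φ A).2 hp'
    (fun x' hx' => by
      obtain ⟨x, hx, h⟩ := exists_map_unitState_eq hC hφ hpres hx'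
      rw [hA h]
      exact strengthAlong_pairOperator_le hp hqn hpq hx)
    (fun x' hx' hne => by
      obtain ⟨x, hx, h⟩ := exists_map_unitState_eq hC hφ hpres hx'
      rw [hA h] at hne ⊢
      exact le_strengthAlong_pairOperator hp hqn hpq hx hne)
    (by
      rw [hA hpp', strengthAlong_pairOperator hp hqn hpq hp (a := 1) (b := 0) (by simp),
        inner_self_eq_norm_sq_to_K, hp]
      norm_num)
  have h1 := hA hrr'
  have h2 := strengthAlong_pairOperator hp hqn hpq hr hrq
  have h3 : strengthAlong (pairOperator p q) r ≠ 0 := by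
    rw [h2]
    have h4 : ‖inner ℂ p r‖ ≤ 1 := by simpa [hp, hr] using norm_inner_le_norm (𝕜 := ℂ) p r
    have h5 : ‖inner ℂ p r‖ ^ 2 ≤ 1 := pow_le_one₀ (norm_nonneg _) h4
    apply inv_ne_zero
    linarith
  rw [← h1, hφA] at h3
  have h6 := eq_of_strengthAlong_pairOperator_ne_zero hp' hu hpu h3
  rw [hφA, strengthAlong_pairOperator hp' hu hpu hr' h6, h2, inv_inj] at h1
  exact (sq_eq_sq₀ (norm_nonneg _) (norm_nonneg _)).1 (by linarith)

/-- A representative of each image line is chosen arbitrarily and scaled by `‖x‖`, so `f` is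
controlled only up to phase. -/
theorem exists_ray_map [Nontrivial H] :
    ∃ f : H → H, (∀ x y, ‖inner ℂ (f x) (f y)‖ = ‖inner ℂ x y‖) ∧
      (∀ y, ∃ x, ∃ c : ℂ, y = c • f x) ∧
      ∀ x, ‖x‖ = 1 → ‖f x‖ = 1 ∧ ∀ A : stateSet H,
        strengthAlong (φ A : H →L[ℂ] H) (f x) = strengthAlong (A : H →L[ℂ] H) x := by
  have hex (x : H) : ∃ x' u u' : H, ∃ (hu : ‖u‖ = 1) (hu' : ‖u'‖ = 1), x = (‖x‖ : ℂ) • u ∧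
      x' = (‖x‖ : ℂ) • u' ∧ φ (unitState u hu) = unitState u' hu' := by
    obtain ⟨u, hu, hx⟩ := exists_eq_norm_smul x
    obtain ⟨u', hu', h⟩ :=
      (exists_eq_unitState_map_iff hC hφ hpres (unitState u hu)).2 ⟨u, hu, rfl⟩
    exact ⟨_, u, u', hu, hu', hx, rfl, h⟩
  choose f u u' hu hu' hxu hfu hφu using hex
  have hone {x : H} (hx : ‖x‖ = 1) : u x = x ∧ f x = u' x := by
    have h1 := hxu x
    have h2 := hfu x
    rw [hx] at h1 h2
    exact ⟨by simpa using h1.symm, by simpa using h2⟩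
  refine ⟨f, fun x y => ?_, fun y => ?_, fun x hx => ⟨by rw [(hone hx).2, hu'], fun A => ?_⟩⟩
  · rw [hfu x, hfu y]
    conv_rhs => rw [hxu x, hxu y]
    simp only [inner_smul_left, inner_smul_right, norm_mul]
    rw [norm_inner_eq_of_map_unitState_eq hC hφ hpres (hφu x) (hφu y)]
  · obtain ⟨v, hv, hyv⟩ := exists_eq_norm_smul y
    obtain ⟨x, hx, hxv⟩ := exists_map_unitState_eq hC hφ hpres hv
    have hst : unitState v hv = unitState (u' x) (hu' x) := by
      rw [← hxv, ← hφu x]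
      congr 2
      exact (hone hx).1.symm
    obtain ⟨c, -, hc⟩ := exists_eq_smul_of_unitState_eq hst
    exact ⟨x, (‖y‖ : ℂ) * c, by rw [(hone hx).2, mul_smul, ← hc, ← hyv]⟩
  · rw [(hone hx).2, strengthAlong_map hC hpres A (hφu x), (hone hx).1]

end Preserver

theorem eq_conj_of_strengthAlong_eq {σ : ℂ →+* ℂ} [RingHomInvPair σ σ]
    (hσ : ∀ z, ‖σ z‖ = ‖z‖) (hσr : ∀ t : ℝ, σ t = t) (U : H ≃ₛₗᵢ[σ] H)
    (hU : ∀ x y, inner ℂ (U x) (U y) = σ (inner ℂ x y)) {A B : H →L[ℂ] H} (hA : A ∈ stateSet H)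
    (hB : B ∈ stateSet H)
    (h : ∀ x, ‖x‖ = 1 → strengthAlong B (U x) = strengthAlong A x) (x : H) :
    B x = U (A (U.symm x)) := by
  have hform (y : H) : (inner ℂ (A y) y).re = (inner ℂ (B (U y)) (U y)).re := by
    apply le_antisymm
    · exact re_inner_apply_le_of_strengthAlong_le hA hB.1 (g := U) (fun x hx => (h x hx).ge)
        (fun x => by rw [hU, hσ])
    · refine re_inner_apply_le_of_strengthAlong_le hB hA.1 (g := U.symm) (fun x hx => ?_)
        (fun x => ?_)
      · rw [← h _ (by rw [U.symm.norm_map, hx]), U.apply_symm_apply]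
      · rw [← hσ, ← hU, U.apply_symm_apply]
  -- Conjugating by `U` applies `σ` twice, so `T` is complex linear even for antiunitary `U`, and a
  -- complex linear map with zero quadratic form vanishes.
  let T : H →ₗ[ℂ] H :=
    { toFun := fun x => U.symm (B (U x)) - A x
      map_add' := fun x y => by simp only [map_add]; abel
      map_smul' := fun c x => by
        simp only [map_smulₛₗ, RingHom.id_apply, smul_sub, RingHomInvPair.comp_apply_eq] }
  have hT : T = 0 := by
    rw [← inner_map_self_eq_zero]
    intro y
    change inner ℂ (U.symm (B (U y)) - A y) y = 0
    have h1 : σ (inner ℂ (U.symm (B (U y))) y) = σ (inner ℂ (A y) y) := by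
      rw [← hU, U.apply_symm_apply, inner_apply_eq_ofReal hB.1, ← hform, ← hσr,
        ← inner_apply_eq_ofReal hA.1]
    rw [inner_sub_left, σ.injective h1, sub_self]
  have h2 : U.symm (B (U (U.symm x))) - A (U.symm x) = 0 := LinearMap.congr_fun hT (U.symm x)
  rw [sub_eq_zero, U.apply_symm_apply] at h2
  rw [← h2, U.apply_symm_apply]

omit [CompleteSpace H] in
theorem strengthAlong_eq_of_ray {f U : H → H} (hUn : ∀ x, ‖U x‖ = ‖x‖)
    (hfU : ∀ x, ∃ c : ℂ, f x = c • U x) {B : H →L[ℂ] H} {x : H} (hx : ‖x‖ = 1) (hfx : ‖f x‖ = 1) :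
    strengthAlong B (U x) = strengthAlong B (f x) := by
  obtain ⟨c, hc⟩ := hfU x
  have hc1 : ‖c‖ = 1 := by rwa [hc, norm_smul, hUn, hx, mul_one] at hfx
  rw [hc, strengthAlong_smul B hc1]

end CompatibilityPreservers

/-- A unitary operator is a surjective linear isometry, an antiunitary operator a surjective
conjugate-linear isometry; in both cases `U* = U⁻¹`. -/
theorem mainTheorem1 {H : Type u} [NormedAddCommGroup H] [InnerProductSpace ℂ H] [CompleteSpace H]
    (C : stateSet H → stateSet H → ℝ) (hC : IsCompatibilityLike C)
    (φ : stateSet H → stateSet H) (hφ : Function.Bijective φ)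
    (hpres : ∀ A B : stateSet H, C (φ A) (φ B) = C A B) :
    (∃ U : H ≃ₗᵢ[ℂ] H, ∀ (A : stateSet H) (x : H),
      (φ A : H →L[ℂ] H) x = U ((A : H →L[ℂ] H) (U.symm x))) ∨
    (∃ U : H ≃ₛₗᵢ[starRingEnd ℂ] H, ∀ (A : stateSet H) (x : H),
      (φ A : H →L[ℂ] H) x = U ((A : H →L[ℂ] H) (U.symm x))) := by
  rcases subsingleton_or_nontrivial H with hH | hH
  · exact Or.inl ⟨.refl ℂ H, fun A x => Subsingleton.elim _ _⟩
  obtain ⟨f, hf, hsurj, hstr⟩ := exists_ray_map hC hφ hpres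
  refine (wigner hf hsurj).imp ?_ ?_
  · rintro ⟨U, hU⟩
    refine ⟨U, fun A x => ?_⟩
    exact eq_conj_of_strengthAlong_eq (σ := RingHom.id ℂ) (fun _ => rfl) (fun _ => rfl) U
      U.inner_map_map A.2 (φ A).2 (fun x hx => by
        rw [strengthAlong_eq_of_ray U.norm_map hU hx (hstr x hx).1, (hstr x hx).2]) x
  · rintro ⟨U, hU⟩
    refine ⟨U, fun A x => ?_⟩
    exact eq_conj_of_strengthAlong_eq (fun z => RCLike.norm_conj z) Complex.conj_ofReal U
      (inner_map_map_of_conj_linearIsometry U.toLinearIsometry) A.2 (φ A).2 (fun x hx => by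
        rw [strengthAlong_eq_of_ray U.norm_map hU hx (hstr x hx).1, (hstr x hx).2]) x
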